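/- Let $\mu$ be a probability measure on $\mathbb{R}$ and let $a,b\in\mathbb{R}$ satisfy $b-a>1$, $\mathrm{Supp}(\mu)\subset[a,b]$ and $\{a,b\}\subset\mathrm{Supp}(\mu)$. Assume that there are integers $x^{(n)}_1>x^{(n)}_2>\cdots>x^{(n)}_n$, for each $n\ge1$, such that $\frac1n\sum_{i=1}^n\delta_{x^{(n)}_i/n}\to\mu$ weakly as $n\to\infty$ (consequently $\mu\le\lambda$, where $\lambda$ is Lebesgue measure). For $(\chi,\eta)\in[a,b]\times[0,1]$ with $b\ge\chi\ge\chi+\eta-1\ge a$, set $$S_1:=\mathrm{Supp}(\mu|_{[\chi,b]}),\quad S_2:=\mathrm{Supp}((\lambda-\mu)|_{[\chi+\eta-1,\chi]}),\quad S_3:=\mathrm{Supp}(\mu|_{[a,\chi+\eta-1]}),\quad S:=S_1\cup S_2\cup S_3,$$ and let $f'=f'_{(\chi,\eta)}:\mathbb{C}\setminus S\to\mathbb{C}$ be the analytic function $$f'(w)=\int_{[\chi,b]}\frac{\mu[dx]}{w-x}-\int_{[\chi+\eta-1,\chi]}\frac{(\lambda-\mu)[dx]}{w-x}+\int_{[a,\chi+\eta-1]}\frac{\mu[dx]}{w-x}.$$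 A root of $f'$ is a zero in its domain $\mathbb{C}\setminus S$, and a repeated root is a zero of multiplicity at least $2$. Define the following sets of points $(\chi,\eta)\in[a,b]\times[0,1]$ with $b\ge\chi\ge\chi+\eta-1\ge a$: - $\mathcal{L}$: those for which $f'$ has a root in $\mathbb{C}\setminus\mathbb{R}$; - $\mathcal{E}_\mu$: those for which $f'$ has a repeated root in $\mathbb{R}\setminus[\chi+\eta-1,\chi]$; - $\mathcal{E}_{\lambda-\mu}$: those for which $f'$ has a repeated root in $(\chi+\eta-1,\chi)$; - $\mathcal{E}_0$: those for which $\eta=1$ and $f'$ has a root at $\chi$ $(=\chi+\eta-1)$; - $\mathcal{E}_1$: those for which $\eta<1$ and $f'$ has a root at $\chi$; - $\mathcal{E}_2$: those for which $\eta<1$ and $f'$ has a root at $\chi+\eta-1$. Let $\mathcal{E}:=\mathcal{E}_\mu\cup\mathcal{E}_{\lambda-\mu}\cup\mathcal{E}_0\cup\mathcal{E}_1\cup\mathcal{E}_2$. Then: (a) $S_1$, $S_2$ and $S_3$ are all non-empty whenever $(\chi,\eta)\in\mathcal{L}\cup\mathcal{E}_\mu\cup\mathcal{E}_{\lambda-\mu}$.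 (b) $\eta>0$ whenever $(\chi,\eta)\in\mathcal{L}\cup\mathcal{E}$. (c) The sets $\mathcal{L},\mathcal{E}_\mu,\mathcal{E}_{\lambda-\mu},\mathcal{E}_0,\mathcal{E}_1,\mathcal{E}_2$ are pairwise disjoint. -/

import Mathlib

open MeasureTheory Filter Set
open scoped Topology NNReal

namespace GelfandTsetlin

noncomputable section

/-- The rescaled empirical measure `(1/n) ∑ δ_{x_i / n}` of `n` integer particles
(as a finite measure; it is a probability measure for `n ≥ 1`). -/
def empiricalMeasure {n : ℕ} (x : Fin n → ℤ) : FiniteMeasure ℝ :=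
  (n : ℝ≥0)⁻¹ • ∑ i, (diracProba ((x i : ℝ) / (n : ℝ))).toFiniteMeasure

/-- The region `{(χ, η) ∈ [a, b] × [0, 1] : b ≥ χ ≥ χ + η - 1 ≥ a}`. -/
def shape (a b : ℝ) : Set (ℝ × ℝ) :=
  {p | p.1 ∈ Icc a b ∧ p.2 ∈ Icc (0 : ℝ) 1 ∧ p.1 ≤ b ∧ p.1 + p.2 - 1 ≤ p.1 ∧ a ≤ p.1 + p.2 - 1}

/-- `S₁ = Supp (μ|_[χ, b])`. -/
def S₁ (μ : Measure ℝ) (b χ : ℝ) : Set ℝ := (μ.restrict (Icc χ b)).support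

/-- `S₂ = Supp ((λ - μ)|_[χ + η - 1, χ])`, with `λ` Lebesgue measure. -/
def S₂ (μ : Measure ℝ) (χ η : ℝ) : Set ℝ :=
  (((volume : Measure ℝ) - μ).restrict (Icc (χ + η - 1) χ)).support

/-- `S₃ = Supp (μ|_[a, χ + η - 1])`. -/
def S₃ (μ : Measure ℝ) (a χ η : ℝ) : Set ℝ := (μ.restrict (Icc a (χ + η - 1))).support

/-- `S = S₁ ∪ S₂ ∪ S₃`. -/
def S (μ : Measure ℝ) (a b χ η : ℝ) : Set ℝ := S₁ μ b χ ∪ S₂ μ χ η ∪ S₃ μ a χ η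

/-- The function `f'_{(χ, η)}`, given by its integral formula. It is meaningful (and analytic)
on the domain `ℂ \ S`, and only ever used there. -/
def f' (μ : Measure ℝ) (a b χ η : ℝ) (w : ℂ) : ℂ :=
  (∫ x in Icc χ b, 1 / (w - (x : ℂ)) ∂μ)
    - (∫ x in Icc (χ + η - 1) χ, 1 / (w - (x : ℂ)) ∂((volume : Measure ℝ) - μ))
    + (∫ x in Icc a (χ + η - 1), 1 / (w - (x : ℂ)) ∂μ)

/-- `w` is a root of `f'_{(χ, η)} : ℂ \ S → ℂ`. -/
def IsRootAt (μ : Measure ℝ) (a b χ η : ℝ) (w : ℂ) : Prop :=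
  w ∉ Complex.ofReal '' S μ a b χ η ∧ f' μ a b χ η w = 0

/-- `w` is a repeated root of `f'_{(χ, η)} : ℂ \ S → ℂ`, i.e. a root of multiplicity
(order of vanishing) at least two. -/
def IsRepeatedRootAt (μ : Measure ℝ) (a b χ η : ℝ) (w : ℂ) : Prop :=
  IsRootAt μ a b χ η w ∧ 2 ≤ analyticOrderAt (f' μ a b χ η) w

/-- The liquid region. -/
def liquid (μ : Measure ℝ) (a b : ℝ) : Set (ℝ × ℝ) :=
  {p | p ∈ shape a b ∧ ∃ w : ℂ, w.im ≠ 0 ∧ IsRootAt μ a b p.1 p.2 w}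

/-- `E_μ`. -/
def edgeMu (μ : Measure ℝ) (a b : ℝ) : Set (ℝ × ℝ) :=
  {p | p ∈ shape a b ∧
    ∃ t : ℝ, t ∉ Icc (p.1 + p.2 - 1) p.1 ∧ IsRepeatedRootAt μ a b p.1 p.2 (t : ℂ)}

/-- `E_{λ - μ}`. -/
def edgeLambdaSubMu (μ : Measure ℝ) (a b : ℝ) : Set (ℝ × ℝ) :=
  {p | p ∈ shape a b ∧
    ∃ t : ℝ, t ∈ Ioo (p.1 + p.2 - 1) p.1 ∧ IsRepeatedRootAt μ a b p.1 p.2 (t : ℂ)}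

/-- `E_0`. -/
def edge₀ (μ : Measure ℝ) (a b : ℝ) : Set (ℝ × ℝ) :=
  {p | p ∈ shape a b ∧ p.2 = 1 ∧ IsRootAt μ a b p.1 p.2 (p.1 : ℂ)}

/-- `E_1`. -/
def edge₁ (μ : Measure ℝ) (a b : ℝ) : Set (ℝ × ℝ) :=
  {p | p ∈ shape a b ∧ p.2 < 1 ∧ IsRootAt μ a b p.1 p.2 (p.1 : ℂ)}

/-- `E_2`. -/
def edge₂ (μ : Measure ℝ) (a b : ℝ) : Set (ℝ × ℝ) :=
  {p | p ∈ shape a b ∧ p.2 < 1 ∧ IsRootAt μ a b p.1 p.2 ((p.1 + p.2 - 1 : ℝ) : ℂ)}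

/-- The edge `E = E_μ ∪ E_{λ - μ} ∪ E_0 ∪ E_1 ∪ E_2`. -/
def edge (μ : Measure ℝ) (a b : ℝ) : Set (ℝ × ℝ) :=
  edgeMu μ a b ∪ edgeLambdaSubMu μ a b ∪ edge₀ μ a b ∪ edge₁ μ a b ∪ edge₂ μ a b

end

end GelfandTsetlin

/-! ### Domination of the weak limit by Lebesgue measure. -/

namespace GelfandTsetlin

/-! Off `S`, `f'` is the Cauchy transform of a signed measure `s • N`, where `N` is
`variationMeasure` and the sign `s` is `-1` exactly on `(χ + η - 1, χ)`. Hence `s x * ((x - χ) * (x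
- (χ + η - 1)))` is nonnegative. Since `μ ≤ volume`, `N` has no atoms, so a function whose sign
agrees with `s`, with at most two zeros, can have signed integral zero only if `N = 0`. But `N ≠ 0`,
because `b - a > 1`.

Each root supplies vanishing signed integrals. A non-real root `u + v i`, or a repeated real root
`u` (with `v = 0`), kills every affine function divided by `D = (x - u)² + v²`; a root at an
endpoint `t` kills `1 / (x - t)`. Partial fractions combine these into a forbidden function.

For (a), if one of the three supports is empty, `s` agrees with the sign of an affine function. For
(b), the signed mass is `η`; if `η = 0`, one root suffices. For (c), two distinct roots of the
listed kinds allow the numerator `(x - χ) * (x - (χ + η - 1))`, up to cancellation at an endpoint.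
-/

lemma empiricalMeasure_apply {n : ℕ} (x : Fin n → ℤ) {A : Set ℝ} (hA : MeasurableSet A) :
    (empiricalMeasure x : Measure ℝ) A
      = (n : ENNReal)⁻¹ * ∑ i, A.indicator 1 ((x i : ℝ) / (n : ℝ)) := by
  rcases Nat.eq_zero_or_pos n with rfl | hn
  · simp [empiricalMeasure]
  · have hn0 : (n : ℝ≥0) ≠ 0 := by positivity
    simp [empiricalMeasure, FiniteMeasure.toMeasure_smul, FiniteMeasure.toMeasure_sum,
      Measure.smul_apply, Measure.finsetSum_apply, diracProba, ENNReal.smul_def, ENNReal.coe_inv hn0]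
    exact congrArg _ (Finset.sum_congr rfl fun i _ => Measure.dirac_apply' _ hA)

/-- Distinct integers in `[nc, nd]` number at most `n(d - c) + 1`; the extra particle costs `1 / n`.
-/
lemma empiricalMeasure_Icc_le {n : ℕ} (hn : 0 < n) {x : Fin n → ℤ} (hx : StrictAnti x)
    {c d : ℝ} (hcd : c ≤ d) :
    (empiricalMeasure x : Measure ℝ) (Icc c d) ≤ ENNReal.ofReal (d - c + 1 / n) := by
  classical
  have hn' : (0 : ℝ) < n := by exact_mod_cast hn
  rw [empiricalMeasure_apply x measurableSet_Icc]
  set T : Finset (Fin n) := Finset.univ.filter fun i => (x i : ℝ) / n ∈ Icc c d with hT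
  have hsum : ∑ i, (Icc c d).indicator (1 : ℝ → ENNReal) ((x i : ℝ) / (n : ℝ)) = T.card := by
    simp [Set.indicator_apply, hT]
  have hcard : (T.card : ℝ) ≤ n * (d - c) + 1 := by
    have h1 : T.card ≤ (Finset.Icc ⌈n * c⌉ ⌊n * d⌋).card := by
      refine Finset.card_le_card_of_injOn x (fun i hi => ?_) hx.injective.injOn
      have hi' : (x i : ℝ) / n ∈ Icc c d := by simpa [hT] using hi
      rw [mem_Icc, le_div_iff₀ hn', div_le_iff₀ hn'] at hi'
      simp only [Finset.coe_Icc, mem_Icc, Int.ceil_le, Int.le_floor]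
      constructor <;> linarith [hi'.1, hi'.2]
    have h2 : (((⌊n * d⌋ + 1 - ⌈n * c⌉).toNat : ℤ) : ℝ) ≤ n * (d - c) + 1 := by
      rw [Int.toNat_eq_max]
      push_cast
      refine max_le ?_ ?_
      · linarith [Int.floor_le (n * d), Int.le_ceil (n * c)]
      · nlinarith
    rw [Int.card_Icc] at h1
    calc (T.card : ℝ) ≤ ((⌊n * d⌋ + 1 - ⌈n * c⌉).toNat : ℝ) := by exact_mod_cast h1
      _ ≤ _ := by exact_mod_cast h2
  rw [hsum, mul_comm, ← div_eq_mul_inv]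
  refine ENNReal.div_le_of_le_mul ?_
  rw [← ENNReal.ofReal_natCast n, ← ENNReal.ofReal_mul (by positivity [sub_nonneg.2 hcd]),
    ← ENNReal.ofReal_natCast T.card]
  refine ENNReal.ofReal_le_ofReal (hcard.trans_eq ?_)
  field_simp

lemma measure_Icc_le_of_tendsto_empiricalMeasure {μ : FiniteMeasure ℝ}
    {x : (n : ℕ) → Fin n → ℤ} (hx : ∀ n, StrictAnti (x n))
    (hlim : Tendsto (fun n : ℕ => empiricalMeasure (x n)) atTop (𝓝 μ)) {c d : ℝ} (hcd : c ≤ d) :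
    (μ : Measure ℝ) (Icc c d) ≤ ENNReal.ofReal (d - c) := by
  -- A continuous cutoff lies between the indicators of `[c, d]` and `[c - δ, d + δ]`, so weak
  -- convergence applies to it; afterwards `δ → 0`.
  have key : ∀ δ : ℝ, 0 < δ → (μ : Measure ℝ) (Icc c d) ≤ ENNReal.ofReal (d - c + 2 * δ) := by
    intro δ hδ
    set f := thickenedIndicator hδ (Icc c d)
    have h1 : (μ : Measure ℝ) (Icc c d) ≤ ∫⁻ y, f y ∂(μ : Measure ℝ) := by
      rw [← lintegral_indicator_one measurableSet_Icc]
      refine lintegral_mono fun y => ?_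
      by_cases hy : y ∈ Icc c d
      · simp [hy, f, thickenedIndicator_one hδ _ hy]
      · simp [hy]
    have h2 : ∀ n : ℕ, 0 < n → ∫⁻ y, f y ∂(empiricalMeasure (x n) : Measure ℝ)
        ≤ ENNReal.ofReal (d - c + 2 * δ + 1 / n) := by
      intro n hn
      have h3 : ∫⁻ y, f y ∂(empiricalMeasure (x n) : Measure ℝ)
          ≤ (empiricalMeasure (x n) : Measure ℝ) (Icc (c - δ) (d + δ)) := by
        rw [← lintegral_indicator_one measurableSet_Icc]
        refine lintegral_mono fun y => ?_
        by_cases hy : y ∈ Icc (c - δ) (d + δ)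
        · simpa only [hy, indicator_of_mem, Pi.one_apply, ENNReal.coe_le_one_iff] using
            thickenedIndicator_le_one hδ (Icc c d) y
        · have : y ∉ Metric.thickening δ (Icc c d) := by
            intro h
            obtain ⟨z, hz, hyz⟩ := Metric.mem_thickening_iff.1 h
            rw [Real.dist_eq, abs_lt] at hyz
            exact hy ⟨by linarith [hz.1], by linarith [hz.2]⟩
          simp [hy, f, thickenedIndicator_zero hδ _ this]
      refine h3.trans ((empiricalMeasure_Icc_le hn (hx n) (by linarith)).trans_eq ?_)
      congr 1; ring
    refine h1.trans (le_of_tendsto_of_tendsto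
      (FiniteMeasure.tendsto_iff_forall_lintegral_tendsto.1 hlim f) ?_
      ((eventually_gt_atTop 0).mono h2))
    have := (tendsto_one_div_atTop_nhds_zero_nat (𝕜 := ℝ)).const_add (d - c + 2 * δ)
    rw [add_zero] at this
    exact (ENNReal.continuous_ofReal.tendsto _).comp this
  have ht : Tendsto (fun δ : ℝ => ENNReal.ofReal (d - c + 2 * δ)) (𝓝[>] 0)
      (𝓝 (ENNReal.ofReal (d - c))) := by
    have : Continuous fun δ : ℝ => ENNReal.ofReal (d - c + 2 * δ) :=
      ENNReal.continuous_ofReal.comp (by fun_prop)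
    simpa using (this.tendsto 0).mono_left nhdsWithin_le_nhds
  exact ge_of_tendsto ht (eventually_mem_nhdsWithin.mono key)

/-- Lebesgue outer measure is the largest outer measure bounded by the length function, so intervals
suffice. -/
lemma le_volume_of_forall_Icc {μ : Measure ℝ}
    (h : ∀ c d : ℝ, c ≤ d → μ (Icc c d) ≤ ENNReal.ofReal (d - c)) : μ ≤ volume := by
  have h1 : μ.toOuterMeasure ≤ StieltjesFunction.id.outer := by
    refine OuterMeasure.le_ofFunction.2 fun s => ?_
    rw [StieltjesFunction.length_eq]
    refine le_iInf fun c => le_iInf fun d => le_iInf fun hs => ?_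
    have hs' : s ⊆ Ioc c d := fun y hy =>
      hs ⟨hy, notMem_botSet_of_lt (sub_one_lt y)⟩
    rcases le_or_gt c d with hcd | hcd
    · exact (measure_mono (hs'.trans Ioc_subset_Icc_self)).trans (h c d hcd)
    · rw [Ioc_eq_empty hcd.not_gt, subset_empty_iff] at hs'
      simp [hs']
  refine Measure.le_iff.2 fun s hs => ?_
  rw [Real.volume_eq_stieltjes_id]
  refine (h1 s).trans ?_
  rw [StieltjesFunction.measure]
  exact le_rfl

/-- A weak limit of rescaled empirical measures of distinct integers is dominated by Lebesgue
measure. -/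
theorem le_volume_of_tendsto_empiricalMeasure {μ : FiniteMeasure ℝ}
    {x : (n : ℕ) → Fin n → ℤ} (hx : ∀ n, StrictAnti (x n))
    (hlim : Tendsto (fun n : ℕ => empiricalMeasure (x n)) atTop (𝓝 μ)) :
    (μ : Measure ℝ) ≤ volume :=
  le_volume_of_forall_Icc fun _ _ hcd => measure_Icc_le_of_tendsto_empiricalMeasure hx hlim hcd

end GelfandTsetlin

/-! ### Signed integrals that force the carrying measure to vanish. -/

namespace GelfandTsetlin

/-- `K` is a compact carrier of the measure `N`, and `s` is a measurable choice of signs. -/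
structure IsSignedCarrier (N : Measure ℝ) (s : ℝ → ℝ) (K : Set ℝ) : Prop where
  isCompact : IsCompact K
  measure_compl : N Kᶜ = 0
  measurable : Measurable s
  abs_eq_one : ∀ x, |s x| = 1

/-- The conditions on `u + v i` which a non-real root (for `v ≠ 0`) or a repeated real root
(for `v = 0`) of the Cauchy transform of the signed measure `s • N` satisfies. -/
structure IsCritical (N : Measure ℝ) (s : ℝ → ℝ) (K : Set ℝ) (u v : ℝ) : Prop where
  ne_zero : ∀ x ∈ K, (x - u) ^ 2 + v ^ 2 ≠ 0
  integral_inv : ∫ x, s x * (1 / ((x - u) ^ 2 + v ^ 2)) ∂N = 0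
  integral_sub : ∫ x, s x * ((x - u) / ((x - u) ^ 2 + v ^ 2)) ∂N = 0

namespace IsSignedCarrier

variable {N : Measure ℝ} {s : ℝ → ℝ} {K : Set ℝ}

lemma ae_mem (h : IsSignedCarrier N s K) : ∀ᵐ x ∂N, x ∈ K :=
  h.measure_compl

lemma integrable [IsFiniteMeasure N] (h : IsSignedCarrier N s K) {E : Type*}
    [NormedAddCommGroup E] [NormedSpace ℝ E] {g : ℝ → E} (hg : ContinuousOn g K) :
    Integrable (fun x => s x • g x) N := by
  have hint : Integrable g N := by
    have := hg.integrableOn_compact (μ := N) h.isCompact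
    rwa [IntegrableOn, Measure.restrict_eq_self_of_ae_mem h.ae_mem] at this
  exact hint.bdd_smul 1 h.measurable.aestronglyMeasurable
    (Eventually.of_forall fun x => (h.abs_eq_one x).le)

/-- All partial-fraction identities below pass through this form; two-term ones take `g₃ = 0`. The
identity is needed only on `K`, which avoids the poles. -/
lemma integral_comb [IsFiniteMeasure N] (h : IsSignedCarrier N s K) {g g₁ g₂ g₃ : ℝ → ℝ}
    (c₁ c₂ c₃ : ℝ) (h₁ : ContinuousOn g₁ K) (h₂ : ContinuousOn g₂ K) (h₃ : ContinuousOn g₃ K)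
    (hg : ∀ x ∈ K, g x = c₁ * g₁ x + c₂ * g₂ x + c₃ * g₃ x) :
    ∫ x, s x * g x ∂N
      = c₁ * (∫ x, s x * g₁ x ∂N) + c₂ * (∫ x, s x * g₂ x ∂N) + c₃ * ∫ x, s x * g₃ x ∂N := by
  have i₁ := (h.integrable h₁).const_mul c₁
  have i₂ := (h.integrable h₂).const_mul c₂
  have i₃ := (h.integrable h₃).const_mul c₃
  simp only [smul_eq_mul] at i₁ i₂ i₃
  rw [← integral_const_mul, ← integral_const_mul, ← integral_const_mul,
    ← integral_add i₁ i₂, ← integral_add (by exact i₁.add i₂) i₃]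
  refine integral_congr_ae (h.ae_mem.mono fun x hx => ?_)
  simp only [hg x hx]
  ring

/-- A nonnegative integrand with zero integral vanishes a.e., yet its zeros on `K` lie in a null
two-point set. -/
lemma eq_zero_of_integral_eq_zero [IsFiniteMeasure N] [NullSingletonClass N] (h : IsSignedCarrier N s K)
    {g : ℝ → ℝ} {α β : ℝ} (hg : ContinuousOn g K) (hpos : ∀ᵐ x ∂N, 0 ≤ s x * g x)
    (hzero : ∀ x ∈ K, g x = 0 → x = α ∨ x = β) (hint : ∫ x, s x * g x ∂N = 0) : N = 0 := by
  have h0 := (integral_eq_zero_iff_of_nonneg_ae hpos (h.integrable hg)).1 hint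
  have hα : ∀ᵐ x ∂N, x ≠ α := by simp [ae_iff]
  have hβ : ∀ᵐ x ∂N, x ≠ β := by simp [ae_iff]
  rw [← ae_eq_bot, ← eventually_false_iff_eq_bot]
  filter_upwards [h0, hα, hβ, h.ae_mem] with x hx hxα hxβ hxK
  have hs : s x ≠ 0 := fun hs => by simpa [hs] using h.abs_eq_one x
  rcases hzero x hxK ((mul_eq_zero.1 hx).resolve_left hs) with h | h
  exacts [hxα h, hxβ h]

lemma integral_affine [IsFiniteMeasure N] (h : IsSignedCarrier N s K) {u v : ℝ}
    (hc : IsCritical N s K u v) (c d : ℝ) :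
    ∫ x, s x * ((c + d * x) / ((x - u) ^ 2 + v ^ 2)) ∂N = 0 := by
  have hD := hc.ne_zero
  rw [h.integral_comb (g₁ := fun x => 1 / ((x - u) ^ 2 + v ^ 2))
    (g₂ := fun x => (x - u) / ((x - u) ^ 2 + v ^ 2)) (g₃ := fun _ => 0) (c + d * u) d 0
    (by fun_prop (disch := assumption)) (by fun_prop (disch := assumption)) (by fun_prop)
    (fun x hx => by have := hD x hx; field_simp; ring), hc.integral_inv, hc.integral_sub]
  simp

/-- `(x - α)(x - β)` differs from the denominator by an affine function, whose quotient integrates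
to zero. -/
lemma integral_quadratic [IsFiniteMeasure N] (h : IsSignedCarrier N s K) {u v : ℝ}
    (hc : IsCritical N s K u v) (α β : ℝ) :
    ∫ x, s x * ((x - α) * (x - β) / ((x - u) ^ 2 + v ^ 2)) ∂N = ∫ x, s x * 1 ∂N := by
  have hD := hc.ne_zero
  rw [h.integral_comb (g₁ := fun _ => 1)
    (g₂ := fun x => (α * β - u ^ 2 - v ^ 2 + (2 * u - α - β) * x) / ((x - u) ^ 2 + v ^ 2))
    (g₃ := fun _ => 0) 1 1 0
    (by fun_prop) (by fun_prop (disch := assumption)) (by fun_prop)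
    (fun x hx => by have := hD x hx; field_simp; ring), h.integral_affine hc]
  simp

/-- With `D(x) = (x - u)² + v²`, use `D(x) - D(t) = (x - t)(x + t - 2u)` and divide by `D(t) (x - t)
D(x)`. -/
lemma integral_inv_mul [IsFiniteMeasure N] (h : IsSignedCarrier N s K) {u v t : ℝ}
    (hc : IsCritical N s K u v) (ht : t ∉ K) (hne : (t - u) ^ 2 + v ^ 2 ≠ 0)
    (h1 : ∫ x, s x * (1 / (x - t)) ∂N = 0) :
    ∫ x, s x * (1 / ((x - t) * ((x - u) ^ 2 + v ^ 2))) ∂N = 0 := by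
  have hD := hc.ne_zero
  have hT : ∀ x ∈ K, x - t ≠ 0 := fun x hx h0 => ht (sub_eq_zero.1 h0 ▸ hx)
  rw [h.integral_comb (g₁ := fun x => 1 / (x - t))
    (g₂ := fun x => ((2 * u - t) + (-1) * x) / ((x - u) ^ 2 + v ^ 2)) (g₃ := fun _ => 0)
    (1 / ((t - u) ^ 2 + v ^ 2)) (1 / ((t - u) ^ 2 + v ^ 2)) 0
    (by fun_prop (disch := assumption)) (by fun_prop (disch := assumption)) (by fun_prop)
    (fun x hx => by have := hD x hx; have := hT x hx; field_simp; ring),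
    h.integral_affine hc, h1]
  simp

/-- Divide the previous partial fraction by `x - t` once more, writing `x + t - 2u = (x - t) + 2(t -
u)`. -/
lemma integral_inv_sq_mul [IsFiniteMeasure N] (h : IsSignedCarrier N s K) {u v t : ℝ}
    (hc : IsCritical N s K u v) (ht : t ∉ K) (hne : (t - u) ^ 2 + v ^ 2 ≠ 0)
    (h1 : ∫ x, s x * (1 / (x - t)) ∂N = 0) (h2 : ∫ x, s x * (1 / (x - t) ^ 2) ∂N = 0) :
    ∫ x, s x * (1 / ((x - t) ^ 2 * ((x - u) ^ 2 + v ^ 2))) ∂N = 0 := by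
  have hD := hc.ne_zero
  have hT : ∀ x ∈ K, x - t ≠ 0 := fun x hx h0 => ht (sub_eq_zero.1 h0 ▸ hx)
  have hT2 : ∀ x ∈ K, (x - t) ^ 2 ≠ 0 := fun x hx => pow_ne_zero 2 (hT x hx)
  have hTD : ∀ x ∈ K, (x - t) * ((x - u) ^ 2 + v ^ 2) ≠ 0 := fun x hx =>
    mul_ne_zero (hT x hx) (hD x hx)
  rw [h.integral_comb (g₁ := fun x => 1 / (x - t) ^ 2)
    (g₂ := fun x => 1 / ((x - u) ^ 2 + v ^ 2))
    (g₃ := fun x => 1 / ((x - t) * ((x - u) ^ 2 + v ^ 2)))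
    (1 / ((t - u) ^ 2 + v ^ 2)) (-1 / ((t - u) ^ 2 + v ^ 2))
    (-(2 * (t - u)) / ((t - u) ^ 2 + v ^ 2))
    (by fun_prop (disch := assumption)) (by fun_prop (disch := assumption))
    (by fun_prop (disch := assumption))
    (fun x hx => by have := hD x hx; have := hT x hx; field_simp; ring),
    h2, hc.integral_inv, h.integral_inv_mul hc ht hne h1]
  simp

section Vanishing

variable [IsFiniteMeasure N] [NullSingletonClass N] {α β : ℝ}

lemma eq_zero_of_isCritical_of_affine (h : IsSignedCarrier N s K) {u v : ℝ}
    (hc : IsCritical N s K u v) {c d : ℝ} (hpos : ∀ᵐ x ∂N, 0 ≤ s x * (c + d * x))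
    (hzero : ∀ x, c + d * x = 0 → x = α) : N = 0 := by
  have hD := hc.ne_zero
  refine h.eq_zero_of_integral_eq_zero (α := α) (β := α)
    (g := fun x => (c + d * x) / ((x - u) ^ 2 + v ^ 2)) (by fun_prop (disch := assumption))
    ?_ (fun x hx h0 => Or.inl (hzero x ((div_eq_zero_iff.1 h0).resolve_right (hD x hx))))
    (h.integral_affine hc c d)
  filter_upwards [hpos] with x hx
  rw [← mul_div_assoc]
  positivity

lemma eq_zero_of_isCritical_of_mass (h : IsSignedCarrier N s K)
    (hs : ∀ x, 0 ≤ s x * ((x - α) * (x - β))) {u v : ℝ} (hc : IsCritical N s K u v)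
    (hm : ∫ x, s x * 1 ∂N = 0) : N = 0 := by
  have hD := hc.ne_zero
  refine h.eq_zero_of_integral_eq_zero (α := α) (β := β)
    (g := fun x => (x - α) * (x - β) / ((x - u) ^ 2 + v ^ 2))
    (by fun_prop (disch := assumption)) (Eventually.of_forall fun x => ?_) (fun x hx h0 => ?_)
    ((h.integral_quadratic hc α β).trans hm)
  · have := hs x
    rw [← mul_div_assoc]
    positivity
  · simpa [sub_eq_zero] using (div_eq_zero_iff.1 h0).resolve_right (hD x hx)

/-- `(x - β) / (x - α) = 1 + (α - β) / (x - α)`, and this quotient has the sign of `(x - α)(x - β)`.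
-/
lemma eq_zero_of_endpoint_of_mass (h : IsSignedCarrier N s K)
    (hs : ∀ x, 0 ≤ s x * ((x - α) * (x - β))) (hα : α ∉ K)
    (h1 : ∫ x, s x * (1 / (x - α)) ∂N = 0) (hm : ∫ x, s x * 1 ∂N = 0) : N = 0 := by
  have hT : ∀ x ∈ K, x - α ≠ 0 := fun x hx h0 => hα (sub_eq_zero.1 h0 ▸ hx)
  refine h.eq_zero_of_integral_eq_zero (α := β) (β := β)
    (g := fun x => (x - β) / (x - α))
    (by fun_prop (disch := assumption)) (h.ae_mem.mono fun x hx => ?_) (fun x hx h0 => ?_) ?_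
  · have h2 := hs x
    have h3 := hT x hx
    have : s x * ((x - β) / (x - α)) = s x * ((x - α) * (x - β)) / (x - α) ^ 2 := by
      field_simp
    rw [this]
    positivity
  · simpa [sub_eq_zero] using (div_eq_zero_iff.1 h0).resolve_right (hT x hx)
  · rw [h.integral_comb (g₁ := fun _ => 1) (g₂ := fun x => 1 / (x - α)) (g₃ := fun _ => 0)
      1 (α - β) 0 (by fun_prop) (by fun_prop (disch := assumption)) (by fun_prop)
      (fun x hx => by have := hT x hx; field_simp; ring), hm, h1]
    simp

lemma eq_zero_of_isCritical_of_isCritical (h : IsSignedCarrier N s K)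
    (hs : ∀ x, 0 ≤ s x * ((x - α) * (x - β))) {u v t : ℝ} (hc : IsCritical N s K u v)
    (hct : IsCritical N s K t 0) (hne : (t - u) ^ 2 + v ^ 2 ≠ 0) : N = 0 := by
  have hD := hc.ne_zero
  have hT : ∀ x ∈ K, x - t ≠ 0 := fun x hx h0 => hct.ne_zero x hx (by simp [h0])
  have ht : t ∉ K := fun ht => hT t ht (sub_self t)
  have hTD : ∀ x ∈ K, (x - t) ^ 2 * ((x - u) ^ 2 + v ^ 2) ≠ 0 := fun x hx =>
    mul_ne_zero (pow_ne_zero 2 (hT x hx)) (hD x hx)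
  have hTD1 : ∀ x ∈ K, (x - t) * ((x - u) ^ 2 + v ^ 2) ≠ 0 := fun x hx =>
    mul_ne_zero (hT x hx) (hD x hx)
  have h2 : ∫ x, s x * (1 / (x - t) ^ 2) ∂N = 0 := by simpa using hct.integral_inv
  have h1 : ∫ x, s x * (1 / (x - t)) ∂N = 0 := by
    refine Eq.trans (integral_congr_ae (h.ae_mem.mono fun x hx => ?_)) hct.integral_sub
    have := hT x hx
    simp only
    field_simp
    simp
  refine h.eq_zero_of_integral_eq_zero (α := α) (β := β)
    (g := fun x => (x - α) * (x - β) / ((x - t) ^ 2 * ((x - u) ^ 2 + v ^ 2)))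
    (by fun_prop (disch := assumption)) (Eventually.of_forall fun x => ?_) (fun x hx h0 => ?_) ?_
  · have := hs x
    rw [← mul_div_assoc]
    positivity
  · simpa [sub_eq_zero] using (div_eq_zero_iff.1 h0).resolve_right (hTD x hx)
  · rw [h.integral_comb (g₁ := fun x => 1 / ((x - u) ^ 2 + v ^ 2))
      (g₂ := fun x => 1 / ((x - t) * ((x - u) ^ 2 + v ^ 2)))
      (g₃ := fun x => 1 / ((x - t) ^ 2 * ((x - u) ^ 2 + v ^ 2)))
      -- The coefficients are those of the expansion of `(x - α)(x - β)` in powers of `x - t`.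
      1 (2 * t - α - β) ((t - α) * (t - β)) (by fun_prop (disch := assumption))
      (by fun_prop (disch := assumption)) (by fun_prop (disch := assumption))
      (fun x hx => by have := hD x hx; have := hT x hx; field_simp; ring),
      hc.integral_inv, h.integral_inv_mul hc ht hne h1, h.integral_inv_sq_mul hc ht hne h1 h2]
    simp

/-- The pole at `α` is simple, so the factor `x - α` moves to the denominator without changing the
sign. -/
lemma eq_zero_of_isCritical_of_endpoint (h : IsSignedCarrier N s K)
    (hs : ∀ x, 0 ≤ s x * ((x - α) * (x - β))) {u v : ℝ} (hc : IsCritical N s K u v)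
    (hα : α ∉ K) (h1 : ∫ x, s x * (1 / (x - α)) ∂N = 0) (hne : (α - u) ^ 2 + v ^ 2 ≠ 0) :
    N = 0 := by
  have hD := hc.ne_zero
  have hT : ∀ x ∈ K, x - α ≠ 0 := fun x hx h0 => hα (sub_eq_zero.1 h0 ▸ hx)
  have hTD : ∀ x ∈ K, (x - α) * ((x - u) ^ 2 + v ^ 2) ≠ 0 := fun x hx =>
    mul_ne_zero (hT x hx) (hD x hx)
  refine h.eq_zero_of_integral_eq_zero (α := β) (β := β)
    (g := fun x => (x - β) / ((x - α) * ((x - u) ^ 2 + v ^ 2)))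
    (by fun_prop (disch := assumption)) (h.ae_mem.mono fun x hx => ?_) (fun x hx h0 => ?_) ?_
  · have h2 := hs x
    have h3 := hT x hx
    have h4 := hD x hx
    have : s x * ((x - β) / ((x - α) * ((x - u) ^ 2 + v ^ 2)))
        = s x * ((x - α) * (x - β)) / ((x - α) ^ 2 * ((x - u) ^ 2 + v ^ 2)) := by
      field_simp
    rw [this]
    positivity
  · simpa [sub_eq_zero] using (div_eq_zero_iff.1 h0).resolve_right (hTD x hx)
  · rw [h.integral_comb (g₁ := fun x => 1 / ((x - u) ^ 2 + v ^ 2))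
      (g₂ := fun x => 1 / ((x - α) * ((x - u) ^ 2 + v ^ 2))) (g₃ := fun _ => 0)
      1 (α - β) 0 (by fun_prop (disch := assumption)) (by fun_prop (disch := assumption))
      (by fun_prop) (fun x hx => by have := hT x hx; have := hD x hx; field_simp; ring),
      hc.integral_inv, h.integral_inv_mul hc hα hne h1]
    simp

lemma eq_zero_of_endpoint_of_endpoint (h : IsSignedCarrier N s K)
    (hs : ∀ x, 0 ≤ s x * ((x - α) * (x - β))) (hα : α ∉ K) (hβ : β ∉ K) (hne : α ≠ β)
    (h1 : ∫ x, s x * (1 / (x - α)) ∂N = 0) (h2 : ∫ x, s x * (1 / (x - β)) ∂N = 0) : N = 0 := by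
  have hT : ∀ x ∈ K, x - α ≠ 0 := fun x hx h0 => hα (sub_eq_zero.1 h0 ▸ hx)
  have hT' : ∀ x ∈ K, x - β ≠ 0 := fun x hx h0 => hβ (sub_eq_zero.1 h0 ▸ hx)
  have hTT : ∀ x ∈ K, (x - α) * (x - β) ≠ 0 := fun x hx => mul_ne_zero (hT x hx) (hT' x hx)
  refine h.eq_zero_of_integral_eq_zero (α := β) (β := β)
    (g := fun x => 1 / ((x - α) * (x - β)))
    (by fun_prop (disch := assumption)) (h.ae_mem.mono fun x hx => ?_) (fun x hx h0 => ?_) ?_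
  · have h2 := hs x
    have h3 := hT x hx
    have h4 := hT' x hx
    have : s x * (1 / ((x - α) * (x - β)))
        = s x * ((x - α) * (x - β)) / ((x - α) * (x - β)) ^ 2 := by
      field_simp
    rw [this]
    positivity
  · exact absurd h0 (one_div_ne_zero (hTT x hx))
  · have hab : α - β ≠ 0 := sub_ne_zero.2 hne
    rw [h.integral_comb (g₁ := fun x => 1 / (x - α)) (g₂ := fun x => 1 / (x - β))
      (g₃ := fun _ => 0) (1 / (α - β)) (-1 / (α - β)) 0 (by fun_prop (disch := assumption))
      (by fun_prop (disch := assumption)) (by fun_prop)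
      (fun x hx => by have := hT x hx; have := hT' x hx; field_simp; ring), h1, h2]
    simp

end Vanishing

end IsSignedCarrier

end GelfandTsetlin

/-! ### The function `f'` as a signed Cauchy transform. -/

namespace GelfandTsetlin

open Complex in
lemma IsSignedCarrier.hasDerivAt_cauchyTransform {N : Measure ℝ} [IsFiniteMeasure N]
    {s : ℝ → ℝ} {K : Set ℝ} (h : IsSignedCarrier N s K) {w : ℂ} (hw : w ∉ ofReal '' K) :
    HasDerivAt (fun z : ℂ => ∫ x, s x • (1 / (z - (x : ℂ))) ∂N)
      (∫ x, s x • (-1 / (w - (x : ℂ)) ^ 2) ∂N) w := by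
  have hclosed : IsClosed (ofReal '' K) := (h.isCompact.image continuous_ofReal).isClosed
  obtain ⟨ε, hε, hball⟩ := Metric.isOpen_iff.1 hclosed.isOpen_compl w hw
  have hne : ∀ z ∈ Metric.ball w ε, ∀ x ∈ K, z - (x : ℂ) ≠ 0 := fun z hz x hx h0 =>
    hball hz ⟨x, hx, (sub_eq_zero.1 h0).symm⟩
  have hsub : Metric.ball w (ε / 2) ⊆ Metric.ball w ε := Metric.ball_subset_ball (by linarith)
  have hfar : ∀ z ∈ Metric.ball w (ε / 2), ∀ x ∈ K, ε / 2 ≤ ‖z - (x : ℂ)‖ := by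
    intro z hz x hx
    by_contra! hlt
    refine hball (a := (x : ℂ)) ?_ ⟨x, hx, rfl⟩
    rw [Metric.mem_ball, dist_comm] at hz ⊢
    rw [← dist_eq_norm] at hlt
    linarith [dist_triangle w z (x : ℂ)]
  have hcont : ∀ z ∈ Metric.ball w ε, ContinuousOn (fun x : ℝ => 1 / (z - (x : ℂ))) K := by
    intro z hz
    have := hne z hz
    fun_prop (disch := assumption)
  have hcont' : ContinuousOn (fun x : ℝ => -1 / (w - (x : ℂ)) ^ 2) K := by
    have : ∀ x ∈ K, (w - (x : ℂ)) ^ 2 ≠ 0 := fun x hx =>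
      pow_ne_zero 2 (hne w (Metric.mem_ball_self hε) x hx)
    fun_prop (disch := assumption)
  -- On the ball of half radius every `z` stays at distance at least `ε / 2` from `K`, giving a
  -- constant bound.
  refine (hasDerivAt_integral_of_dominated_loc_of_deriv_le
    (F := fun z x => s x • (1 / (z - (x : ℂ)))) (F' := fun z x => s x • (-1 / (z - (x : ℂ)) ^ 2))
    (bound := fun _ => 1 / (ε / 2) ^ 2) (Metric.ball_mem_nhds w (half_pos hε)) ?_
    (h.integrable (hcont w (Metric.mem_ball_self hε))) (h.integrable hcont').1 ?_
    (integrable_const _) ?_).2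
  · filter_upwards [Metric.ball_mem_nhds w hε] with z hz using (h.integrable (hcont z hz)).1
  · filter_upwards [h.ae_mem] with x hx z hz
    rw [norm_smul, norm_div, norm_pow, norm_neg, norm_one, Real.norm_eq_abs, h.abs_eq_one, one_mul]
    have := hfar z hz x hx
    gcongr
  · filter_upwards [h.ae_mem] with x hx z hz
    have h1 := ((hasDerivAt_id z).sub_const (x : ℂ)).fun_inv (hne z (hsub hz) x hx)
    simpa using h1.fun_const_smul (s x)

lemma eq_zero_deriv_of_two_le_analyticOrderAt {f : ℂ → ℂ} {z : ℂ}
    (h : 2 ≤ analyticOrderAt f z) : deriv f z = 0 := by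
  -- The order is `0` by convention where analyticity fails, so order at least two already implies
  -- analyticity.
  have han : AnalyticAt ℂ f z := by
    by_contra hn
    rw [analyticOrderAt_of_not_analyticAt hn] at h
    simp at h
  simpa using (natCast_le_analyticOrderAt_iff_iteratedDeriv_eq_zero (n := 2) han).1
    (by exact_mod_cast h) 1 one_lt_two

/-- The total variation of the signed measure defining `f'`. -/
noncomputable def variationMeasure (μ : Measure ℝ) (a b χ η : ℝ) : Measure ℝ :=
  μ.restrict (Icc χ b) + ((volume : Measure ℝ) - μ).restrict (Icc (χ + η - 1) χ)
    + μ.restrict (Icc a (χ + η - 1))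

open Classical in
/-- The sign of the measure defining `f'`. -/
noncomputable def signDensity (χ η : ℝ) (x : ℝ) : ℝ :=
  if x ∈ Ioo (χ + η - 1) χ then -1 else 1

lemma S_eq_support (μ : Measure ℝ) (a b χ η : ℝ) :
    S μ a b χ η = (variationMeasure μ a b χ η).support := by
  simp [S, S₁, S₂, S₃, variationMeasure, Measure.support_add]

lemma signDensity_mul_nonneg {χ η : ℝ} (hη : η ≤ 1) (x : ℝ) :
    0 ≤ signDensity χ η x * ((x - χ) * (x - (χ + η - 1))) := by
  rw [signDensity]
  split_ifs with hx
  · nlinarith [mul_pos (sub_pos.2 hx.1) (sub_pos.2 hx.2)]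
  · rw [one_mul]
    by_cases h1 : χ ≤ x
    · exact mul_nonneg (by linarith) (by linarith)
    · have : x ≤ χ + η - 1 := by
        by_contra! h2
        exact hx ⟨h2, not_le.1 h1⟩
      exact mul_nonneg_of_nonpos_of_nonpos (by linarith) (by linarith)

lemma nullSingletonClass_of_le {X : Type*} [MeasurableSpace X] {μ ν : Measure X}
    [NullSingletonClass ν] (h : μ ≤ ν) : NullSingletonClass μ :=
  ⟨fun x => le_antisymm ((h _).trans_eq (measure_singleton x)) zero_le⟩

section

variable {μ : Measure ℝ} {a b χ η : ℝ}

lemma isFiniteMeasure_variationMeasure [IsFiniteMeasure μ] :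
    IsFiniteMeasure (variationMeasure μ a b χ η) := by
  have : IsFiniteMeasure (((volume : Measure ℝ) - μ).restrict (Icc (χ + η - 1) χ)) :=
    isFiniteMeasure_of_le (volume.restrict (Icc (χ + η - 1) χ))
      (Measure.restrict_mono le_rfl Measure.sub_le)
  unfold variationMeasure
  infer_instance

lemma nullSingletonClass_variationMeasure (hμ : μ ≤ volume) :
    NullSingletonClass (variationMeasure μ a b χ η) := by
  have := nullSingletonClass_of_le hμ
  have := nullSingletonClass_of_le (Measure.sub_le (μ := (volume : Measure ℝ)) (ν := μ))
  refine ⟨fun x => ?_⟩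
  simp [variationMeasure]

lemma S_subset_Icc (hp : (χ, η) ∈ shape a b) : S μ a b χ η ⊆ Icc a b := by
  obtain ⟨h1, h2, h3, h4, h5⟩ := hp
  simp only at h1 h2 h3 h4 h5
  have hr : ∀ (ν : Measure ℝ) (c d : ℝ), a ≤ c → d ≤ b →
      (ν.restrict (Icc c d)).support ⊆ Icc a b := fun ν c d hc hd =>
    (Measure.support_subset_of_isClosed isClosed_Icc (ae_restrict_mem measurableSet_Icc)).trans
      (Icc_subset_Icc hc hd)
  exact union_subset (union_subset (hr _ _ _ h1.1 le_rfl) (hr _ _ _ h5 h3))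
    (hr _ _ _ le_rfl (h4.trans h3))

lemma isSignedCarrier (hp : (χ, η) ∈ shape a b) :
    IsSignedCarrier (variationMeasure μ a b χ η) (signDensity χ η) (S μ a b χ η) where
  isCompact := by
    refine isCompact_Icc.of_isClosed_subset ?_ (S_subset_Icc hp)
    rw [S_eq_support]
    exact Measure.isClosed_support
  measure_compl := by
    rw [S_eq_support]
    exact Measure.measure_compl_support
  measurable := Measurable.ite measurableSet_Ioo measurable_const measurable_const
  abs_eq_one x := by
    unfold signDensity
    split_ifs <;> simp

lemma integral_signDensity_smul [IsFiniteMeasure μ]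
    (hp : (χ, η) ∈ shape a b) {E : Type*} [NormedAddCommGroup E] [NormedSpace ℝ E]
    {g : ℝ → E} (hg : ContinuousOn g (S μ a b χ η)) :
    ∫ x, signDensity χ η x • g x ∂(variationMeasure μ a b χ η)
      = (∫ x in Icc χ b, g x ∂μ) - (∫ x in Icc (χ + η - 1) χ, g x ∂((volume : Measure ℝ) - μ))
        + ∫ x in Icc a (χ + η - 1), g x ∂μ := by
  have := isFiniteMeasure_variationMeasure (μ := μ) (a := a) (b := b) (χ := χ) (η := η)
  have hns := nullSingletonClass_of_le (Measure.sub_le (μ := (volume : Measure ℝ)) (ν := μ))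
  have hint := (isSignedCarrier (μ := μ) hp).integrable hg
  have hle : χ + η - 1 ≤ χ := hp.2.2.2.1
  unfold variationMeasure at hint ⊢
  rw [integrable_add_measure, integrable_add_measure] at hint
  rw [integral_add_measure (integrable_add_measure.2 hint.1) hint.2,
    integral_add_measure hint.1.1 hint.1.2, sub_eq_add_neg (∫ x in Icc χ b, g x ∂μ),
    ← integral_neg]
  congr 1
  · congr 1
    · refine setIntegral_congr_fun measurableSet_Icc fun x hx => ?_
      simp [signDensity, hx.1]
    -- The sign is `1` at the two endpoints, but `volume - μ` does not charge them.
    · have h1 : ∀ c : ℝ, ∀ᵐ x ∂((volume : Measure ℝ) - μ), x ≠ c := fun c => by simp [ae_iff]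
      refine setIntegral_congr_ae measurableSet_Icc ?_
      filter_upwards [h1 χ, h1 (χ + η - 1)] with x hx hx' hmem
      have : x ∈ Ioo (χ + η - 1) χ := ⟨hmem.1.lt_of_ne hx'.symm, hmem.2.lt_of_ne hx⟩
      simp [signDensity, this]
  · refine setIntegral_congr_fun measurableSet_Icc fun x hx => ?_
    have : x ∉ Ioo (χ + η - 1) χ := fun h => h.1.not_ge hx.2
    simp [signDensity, this]

lemma continuousOn_cauchyKernel {K : Set ℝ} {w : ℂ} (hw : w ∉ Complex.ofReal '' K) :
    ContinuousOn (fun x : ℝ => 1 / (w - (x : ℂ))) K := by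
  have : ∀ x ∈ K, w - (x : ℂ) ≠ 0 := fun x hx h0 => hw ⟨x, hx, (sub_eq_zero.1 h0).symm⟩
  fun_prop (disch := assumption)

lemma f'_eq_integral [IsFiniteMeasure μ] (hp : (χ, η) ∈ shape a b) {w : ℂ}
    (hw : w ∉ Complex.ofReal '' S μ a b χ η) :
    f' μ a b χ η w
      = ∫ x, signDensity χ η x • (1 / (w - (x : ℂ))) ∂(variationMeasure μ a b χ η) :=
  (integral_signDensity_smul hp (continuousOn_cauchyKernel hw)).symm

/-- The middle interval has length `1 - η`; subtracting its `volume - μ` mass leaves `μ [a, b] - (1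
- η) = η`. -/
lemma integral_signDensity [IsProbabilityMeasure μ] (hμ : μ ≤ volume)
    (hsupp : μ.support ⊆ Icc a b) (hp : (χ, η) ∈ shape a b) :
    ∫ x, signDensity χ η x * 1 ∂(variationMeasure μ a b χ η) = η := by
  have hns := nullSingletonClass_of_le hμ
  obtain ⟨h1, h2, h3, h4, h5⟩ := id hp
  simp only at h1 h2 h3 h4 h5
  have hI := integral_signDensity_smul (μ := μ) (g := fun _ => (1 : ℝ)) hp continuousOn_const
  simp only [smul_eq_mul] at hI
  rw [hI]
  simp only [integral_const, smul_eq_mul, mul_one, measureReal_restrict_apply_univ]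
  have hsub : ((volume : Measure ℝ) - μ).real (Icc (χ + η - 1) χ)
      = (1 - η) - μ.real (Icc (χ + η - 1) χ) := by
    rw [measureReal_def, Measure.sub_apply measurableSet_Icc hμ,
      ENNReal.toReal_sub_of_le (hμ _) (by simp), Real.volume_Icc,
      ENNReal.toReal_ofReal (by linarith), measureReal_def]
    ring
  have htot : μ.real (Icc a b) = 1 := by
    rw [measureReal_def, (prob_compl_eq_zero_iff measurableSet_Icc).1
      (measure_mono_null (compl_subset_compl.2 hsupp) Measure.measure_compl_support)]
    simp
  have hsplit : μ.real (Icc a b)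
      = μ.real (Icc a (χ + η - 1)) + μ.real (Icc (χ + η - 1) χ) + μ.real (Icc χ b) := by
    rw [← Icc_union_Ioc_eq_Icc (h5.trans h4) h3, measureReal_union
      (Set.disjoint_left.2 fun x hx hx' => hx'.1.not_ge hx.2) measurableSet_Ioc,
      ← Icc_union_Ioc_eq_Icc h5 h4, measureReal_union
      (Set.disjoint_left.2 fun x hx hx' => hx'.1.not_ge hx.2) measurableSet_Ioc,
      measureReal_congr (Ioc_ae_eq_Icc (μ := μ)), measureReal_congr (Ioc_ae_eq_Icc (μ := μ))]
  rw [hsub]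
  linarith

/-- Otherwise `μ` would be carried by `[χ + η - 1, χ]`, of length at most `1`, which cannot contain
both `a` and `b`. -/
lemma variationMeasure_ne_zero [IsProbabilityMeasure μ] (hab : 1 < b - a)
    (hsupp : μ.support ⊆ Icc a b) (ha : a ∈ μ.support) (hb : b ∈ μ.support)
    (hp : (χ, η) ∈ shape a b) : variationMeasure μ a b χ η ≠ 0 := by
  intro h0
  obtain ⟨h1, h2, h3, h4, h5⟩ := hp
  simp only at h1 h2 h3 h4 h5
  have hz : ∀ A, variationMeasure μ a b χ η A = 0 := fun A => by simp [h0]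
  have hr := hz univ
  simp only [variationMeasure, Measure.add_apply, add_eq_zero, Measure.restrict_apply_univ] at hr
  have hmem : Icc (χ + η - 1) χ ∈ ae μ := by
    rw [mem_ae_iff]
    refine measure_mono_null (t := Icc χ b ∪ Icc a (χ + η - 1) ∪ μ.supportᶜ) ?_ ?_
    · intro x hx
      by_cases hxs : x ∈ μ.support
      · left
        obtain ⟨hxa, hxb⟩ := hsupp hxs
        by_cases hxc : χ + η - 1 ≤ x
        · exact Or.inl ⟨le_of_not_ge fun h => hx ⟨hxc, h⟩, hxb⟩
        · exact Or.inr ⟨hxa, (not_le.1 hxc).le⟩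
      · exact Or.inr hxs
    · rw [measure_union_null_iff, measure_union_null_iff]
      exact ⟨⟨hr.1.1, hr.2⟩, Measure.measure_compl_support⟩
  have hs := Measure.support_subset_of_isClosed isClosed_Icc hmem
  linarith [(hs ha).1, (hs hb).2, h2.1]

lemma IsRootAt.integral_eq_zero [IsFiniteMeasure μ]
    (hp : (χ, η) ∈ shape a b) {t : ℝ} (h : IsRootAt μ a b χ η (t : ℂ)) :
    t ∉ S μ a b χ η ∧
      ∫ x, signDensity χ η x * (1 / (x - t)) ∂(variationMeasure μ a b χ η) = 0 := by
  refine ⟨fun ht => h.1 ⟨t, ht, rfl⟩, ?_⟩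
  have h0 := h.2
  rw [f'_eq_integral hp h.1] at h0
  have h1 : ∀ x : ℝ, signDensity χ η x • (1 / ((t : ℂ) - (x : ℂ)))
      = ((-(signDensity χ η x * (1 / (x - t))) : ℝ) : ℂ) := by
    intro x
    rw [Complex.real_smul, ← neg_sub (x : ℂ) t]
    push_cast
    rw [one_div, one_div, inv_neg]
    ring
  simp_rw [h1] at h0
  rw [integral_complex_ofReal, integral_neg] at h0
  exact neg_eq_zero.1 (Complex.ofReal_eq_zero.1 h0)

lemma IsRepeatedRootAt.isCritical [IsFiniteMeasure μ]
    (hp : (χ, η) ∈ shape a b) {t : ℝ} (h : IsRepeatedRootAt μ a b χ η (t : ℂ)) :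
    IsCritical (variationMeasure μ a b χ η) (signDensity χ η) (S μ a b χ η) t 0 := by
  have := isFiniteMeasure_variationMeasure (μ := μ) (a := a) (b := b) (χ := χ) (η := η)
  have hc := isSignedCarrier (μ := μ) hp
  obtain ⟨ht, hroot⟩ := h.1.integral_eq_zero hp
  have hT : ∀ x ∈ S μ a b χ η, x - t ≠ 0 := fun x hx h0 => ht (sub_eq_zero.1 h0 ▸ hx)
  refine ⟨fun x hx => by simpa using hT x hx, ?_, ?_⟩
  · have hev : f' μ a b χ η =ᶠ[𝓝 (t : ℂ)]
        fun z => ∫ x, signDensity χ η x • (1 / (z - (x : ℂ))) ∂(variationMeasure μ a b χ η) := by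
      have hopen := (hc.isCompact.image Complex.continuous_ofReal).isClosed.isOpen_compl
      filter_upwards [hopen.mem_nhds h.1.1] with z hz using f'_eq_integral hp hz
    have hd := eq_zero_deriv_of_two_le_analyticOrderAt h.2
    rw [hev.deriv_eq, (hc.hasDerivAt_cauchyTransform h.1.1).deriv] at hd
    have h1 : ∀ x : ℝ, signDensity χ η x • (-1 / ((t : ℂ) - (x : ℂ)) ^ 2)
        = ((-(signDensity χ η x * (1 / ((x - t) ^ 2 + 0 ^ 2))) : ℝ) : ℂ) := by
      intro x
      rw [Complex.real_smul, ← neg_sub (x : ℂ) t, neg_sq]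
      push_cast
      ring
    simp_rw [h1] at hd
    rw [integral_complex_ofReal, integral_neg] at hd
    exact neg_eq_zero.1 (Complex.ofReal_eq_zero.1 hd)
  · refine Eq.trans (integral_congr_ae (hc.ae_mem.mono fun x hx => ?_)) hroot
    have := hT x hx
    simp only
    field_simp
    simp

/-- The imaginary and real parts of `f' = 0` give the two conditions; the former is divided by
`w.im`. -/
lemma IsRootAt.isCritical [IsFiniteMeasure μ]
    (hp : (χ, η) ∈ shape a b) {w : ℂ} (hw : w.im ≠ 0) (h : IsRootAt μ a b χ η w) :
    IsCritical (variationMeasure μ a b χ η) (signDensity χ η) (S μ a b χ η) w.re w.im := by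
  have := isFiniteMeasure_variationMeasure (μ := μ) (a := a) (b := b) (χ := χ) (η := η)
  have hint := (isSignedCarrier (μ := μ) hp).integrable (continuousOn_cauchyKernel h.1)
  have h0 := h.2
  rw [f'_eq_integral hp h.1] at h0
  have hnorm : ∀ x : ℝ, Complex.normSq (w - (x : ℂ)) = (x - w.re) ^ 2 + w.im ^ 2 := by
    intro x
    rw [Complex.normSq_apply]
    simp only [Complex.sub_re, Complex.ofReal_re, Complex.sub_im, Complex.ofReal_im]
    ring
  refine ⟨fun x _ => by positivity, ?_, ?_⟩
  · have him := congrArg Complex.im h0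
    rw [← RCLike.im_eq_complex_im, ← integral_im hint] at him
    have h1 : ∀ x : ℝ, RCLike.im (signDensity χ η x • (1 / (w - (x : ℂ))))
        = -w.im * (signDensity χ η x * (1 / ((x - w.re) ^ 2 + w.im ^ 2))) := by
      intro x
      rw [RCLike.im_eq_complex_im, Complex.smul_im, one_div, Complex.inv_im, hnorm]
      simp
      ring
    simp_rw [h1] at him
    rw [integral_const_mul] at him
    exact (mul_eq_zero.1 (by simpa using him)).resolve_left hw
  · have hre := congrArg Complex.re h0
    rw [← RCLike.re_eq_complex_re, ← integral_re hint] at hre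
    have h1 : ∀ x : ℝ, RCLike.re (signDensity χ η x • (1 / (w - (x : ℂ))))
        = -(signDensity χ η x * ((x - w.re) / ((x - w.re) ^ 2 + w.im ^ 2))) := by
      intro x
      rw [RCLike.re_eq_complex_re, Complex.smul_re, one_div, Complex.inv_re, hnorm]
      simp
      ring
    simp_rw [h1] at hre
    rw [integral_neg] at hre
    simpa using hre

end

end GelfandTsetlin

/-! ### Non-emptiness, positivity and disjointness. -/

namespace GelfandTsetlin

variable {μ : Measure ℝ} {a b χ η : ℝ}

lemma exists_isCritical_of_mem [IsFiniteMeasure μ]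
    (h : (χ, η) ∈ liquid μ a b ∪ edgeMu μ a b ∪ edgeLambdaSubMu μ a b) :
    ∃ u v, IsCritical (variationMeasure μ a b χ η) (signDensity χ η) (S μ a b χ η) u v := by
  rcases h with (⟨hp, w, hw, hr⟩ | ⟨hp, t, -, hr⟩) | ⟨hp, t, -, hr⟩
  · exact ⟨_, _, hr.isCritical hp hw⟩
  · exact ⟨_, _, hr.isCritical hp⟩
  · exact ⟨_, _, hr.isCritical hp⟩

lemma mem_shape_of_mem
    (h : (χ, η) ∈ liquid μ a b ∪ edgeMu μ a b ∪ edgeLambdaSubMu μ a b) :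
    (χ, η) ∈ shape a b := by
  rcases h with (h | h) | h <;> exact h.1

/-- Each of the three supports is non-empty at a point admitting a critical pair. -/
lemma IsCritical.nonempty_supports [IsFiniteMeasure μ] (hμ : μ ≤ volume)
    (hp : (χ, η) ∈ shape a b) (hN : variationMeasure μ a b χ η ≠ 0) {u v : ℝ}
    (hc : IsCritical (variationMeasure μ a b χ η) (signDensity χ η) (S μ a b χ η) u v) :
    (S₁ μ b χ).Nonempty ∧ (S₂ μ χ η).Nonempty ∧ (S₃ μ a χ η).Nonempty := by
  have := isFiniteMeasure_variationMeasure (μ := μ) (a := a) (b := b) (χ := χ) (η := η)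
  have := nullSingletonClass_variationMeasure (a := a) (b := b) (χ := χ) (η := η) hμ
  have hs := isSignedCarrier (μ := μ) hp
  have hle : χ + η - 1 ≤ χ := hp.2.2.2.1
  have hne : ∀ c : ℝ, ∀ᵐ x ∂(variationMeasure μ a b χ η), x ≠ c := fun c => by simp [ae_iff]
  have hmem : ∀ (ν : Measure ℝ) (c d : ℝ), ∀ᵐ x ∂(ν.restrict (Icc c d)), x ∈ Icc c d :=
    fun ν c d => ae_restrict_mem measurableSet_Icc
  simp only [S₁, S₂, S₃, Measure.nonempty_support_iff]
  refine ⟨fun h0 => hN ?_, fun h0 => hN ?_, fun h0 => hN ?_⟩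
  -- Without mass on `[χ, b]` the only sign change is at `χ + η - 1`, matched by `(χ + η - 1) - x`.
  · refine hs.eq_zero_of_isCritical_of_affine hc (c := χ + η - 1) (d := -1) (α := χ + η - 1) ?_
      (fun x hx => by linarith)
    have hle' : ∀ᵐ x ∂(variationMeasure μ a b χ η), x ≤ χ := by
      simp only [variationMeasure, ae_add_measure_iff, h0, ae_zero, eventually_bot, true_and]
      exact ⟨(hmem _ _ _).mono fun x hx => hx.2, (hmem _ _ _).mono fun x hx => hx.2.trans hle⟩
    filter_upwards [hle', hne χ] with x hx hx'
    unfold signDensity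
    split_ifs with hI
    · linarith [hI.1]
    · have : x ≤ χ + η - 1 := by
        by_contra! h
        exact hI ⟨h, hx.lt_of_ne hx'⟩
      linarith
  -- Without the middle part the measure is positive, so a constant suffices.
  · refine hs.eq_zero_of_isCritical_of_affine hc (c := 1) (d := 0) (α := 0) ?_
      (fun x hx => by norm_num at hx)
    have hI : ∀ᵐ x ∂(variationMeasure μ a b χ η), x ∉ Ioo (χ + η - 1) χ := by
      simp only [variationMeasure, ae_add_measure_iff, h0, ae_zero, eventually_bot, and_true]
      exact ⟨(hmem _ _ _).mono fun x hx h => h.2.not_ge hx.1,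
        (hmem _ _ _).mono fun x hx h => h.1.not_ge hx.2⟩
    filter_upwards [hI] with x hx
    simp [signDensity, hx]
  -- Without mass on `[a, χ + η - 1]` the only sign change is at `χ`, matched by `x - χ`.
  · refine hs.eq_zero_of_isCritical_of_affine hc (c := -χ) (d := 1) (α := χ) ?_
      (fun x hx => by linarith)
    have hge : ∀ᵐ x ∂(variationMeasure μ a b χ η), χ + η - 1 ≤ x := by
      simp only [variationMeasure, ae_add_measure_iff, h0, ae_zero, eventually_bot, and_true]
      exact ⟨(hmem _ _ _).mono fun x hx => hle.trans hx.1, (hmem _ _ _).mono fun x hx => hx.1⟩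
    filter_upwards [hge, hne (χ + η - 1)] with x hx hx'
    unfold signDensity
    split_ifs with hI
    · linarith [hI.2]
    · have : χ ≤ x := by
        by_contra! h
        exact hI ⟨hx.lt_of_ne hx'.symm, h⟩
      linarith

lemma signDensity_mul_nonneg' (hη : η ≤ 1) (x : ℝ) :
    0 ≤ signDensity χ η x * ((x - (χ + η - 1)) * (x - χ)) := by
  rw [mul_comm (x - (χ + η - 1))]
  exact signDensity_mul_nonneg hη x

lemma pos_of_mem_liquid_union_edge [IsProbabilityMeasure μ] (hμ : μ ≤ volume)
    (hsupp : μ.support ⊆ Icc a b)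
    (hN : ∀ {χ η}, (χ, η) ∈ shape a b → variationMeasure μ a b χ η ≠ 0)
    (h : (χ, η) ∈ liquid μ a b ∪ edge μ a b) : 0 < η := by
  have hp : (χ, η) ∈ shape a b := by
    rcases h with h | (((h | h) | h) | h) | h <;> exact h.1
  have := isFiniteMeasure_variationMeasure (μ := μ) (a := a) (b := b) (χ := χ) (η := η)
  have := nullSingletonClass_variationMeasure (a := a) (b := b) (χ := χ) (η := η) hμ
  have hs := isSignedCarrier (μ := μ) hp
  have hη : η ≤ 1 := hp.2.1.2
  refine lt_of_le_of_ne hp.2.1.1 fun h0 => hN hp ?_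
  have hm := (integral_signDensity hμ hsupp hp).trans h0.symm
  have hcrit (h : (χ, η) ∈ liquid μ a b ∪ edgeMu μ a b ∪ edgeLambdaSubMu μ a b) :
      variationMeasure μ a b χ η = 0 := by
    obtain ⟨u, v, hc⟩ := exists_isCritical_of_mem h
    exact hs.eq_zero_of_isCritical_of_mass (signDensity_mul_nonneg hη) hc hm
  rcases h with h | (((h | h) | h) | h) | h
  · exact hcrit (Or.inl (Or.inl h))
  · exact hcrit (Or.inl (Or.inr h))
  · exact hcrit (Or.inr h)
  · exact absurd (h0.trans h.2.1) zero_ne_one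
  · obtain ⟨h1, h2⟩ := h.2.2.integral_eq_zero hp
    exact hs.eq_zero_of_endpoint_of_mass (signDensity_mul_nonneg hη) h1 h2 hm
  · obtain ⟨h1, h2⟩ := h.2.2.integral_eq_zero hp
    exact hs.eq_zero_of_endpoint_of_mass (signDensity_mul_nonneg' hη) h1 h2 hm

lemma sub_sq_add_sq_ne_zero {t u v : ℝ} (h : v = 0 → t ≠ u) : (t - u) ^ 2 + v ^ 2 ≠ 0 := by
  intro h0
  have hv : v = 0 := by nlinarith [sq_nonneg (t - u), sq_nonneg v]
  exact h hv (by subst hv; simpa [sub_eq_zero] using h0)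

lemma pairwise_disjoint_fin_of_lt {α : Type*} {n : ℕ} (A : Fin n → Set α)
    (h : ∀ i j, i < j → Disjoint (A i) (A j)) : Pairwise (Function.onFun Disjoint A) := by
  intro i j hij
  rcases hij.lt_or_gt with h' | h'
  · exact h i j h'
  · exact (h j i h').symm

lemma pairwise_disjoint_liquid_edges [IsFiniteMeasure μ] (hμ : μ ≤ volume)
    (hN : ∀ {χ η}, (χ, η) ∈ shape a b → variationMeasure μ a b χ η ≠ 0) :
    Pairwise (Function.onFun Disjoint
      (![liquid μ a b, edgeMu μ a b, edgeLambdaSubMu μ a b, edge₀ μ a b, edge₁ μ a b,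
        edge₂ μ a b] : Fin 6 → Set (ℝ × ℝ))) := by
  -- Two special roots at one point must coincide. Below, they differ by being real or not, or by
  -- their position relative to `χ + η - 1` and `χ`; only `edge₀` against `edge₁` or `edge₂` is
  -- decided by `η`.
  have hcc : ∀ {χ η u v t : ℝ}, (χ, η) ∈ shape a b →
      IsCritical (variationMeasure μ a b χ η) (signDensity χ η) (S μ a b χ η) u v →
      IsRepeatedRootAt μ a b χ η (t : ℂ) → ¬ (v = 0 → t ≠ u) := by
    intro χ η u v t hp hc ht hne
    have := isFiniteMeasure_variationMeasure (μ := μ) (a := a) (b := b) (χ := χ) (η := η)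
    have := nullSingletonClass_variationMeasure (a := a) (b := b) (χ := χ) (η := η) hμ
    exact hN hp ((isSignedCarrier hp).eq_zero_of_isCritical_of_isCritical
      (signDensity_mul_nonneg hp.2.1.2) hc (ht.isCritical hp) (sub_sq_add_sq_ne_zero hne))
  have hc1 : ∀ {χ η u v : ℝ}, (χ, η) ∈ shape a b →
      IsCritical (variationMeasure μ a b χ η) (signDensity χ η) (S μ a b χ η) u v →
      IsRootAt μ a b χ η (χ : ℂ) → ¬ (v = 0 → χ ≠ u) := by
    intro χ η u v hp hc ht hne
    have := isFiniteMeasure_variationMeasure (μ := μ) (a := a) (b := b) (χ := χ) (η := η)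
    have := nullSingletonClass_variationMeasure (a := a) (b := b) (χ := χ) (η := η) hμ
    obtain ⟨h1, h2⟩ := ht.integral_eq_zero hp
    exact hN hp ((isSignedCarrier hp).eq_zero_of_isCritical_of_endpoint
      (signDensity_mul_nonneg hp.2.1.2) hc h1 h2 (sub_sq_add_sq_ne_zero hne))
  have hc2 : ∀ {χ η u v : ℝ}, (χ, η) ∈ shape a b →
      IsCritical (variationMeasure μ a b χ η) (signDensity χ η) (S μ a b χ η) u v →
      IsRootAt μ a b χ η ((χ + η - 1 : ℝ) : ℂ) → ¬ (v = 0 → χ + η - 1 ≠ u) := by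
    intro χ η u v hp hc ht hne
    have := isFiniteMeasure_variationMeasure (μ := μ) (a := a) (b := b) (χ := χ) (η := η)
    have := nullSingletonClass_variationMeasure (a := a) (b := b) (χ := χ) (η := η) hμ
    obtain ⟨h1, h2⟩ := ht.integral_eq_zero hp
    exact hN hp ((isSignedCarrier hp).eq_zero_of_isCritical_of_endpoint
      (signDensity_mul_nonneg' hp.2.1.2) hc h1 h2 (sub_sq_add_sq_ne_zero hne))
  have h12 : ∀ {χ η : ℝ}, (χ, η) ∈ shape a b → η < 1 → IsRootAt μ a b χ η (χ : ℂ) →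
      ¬ IsRootAt μ a b χ η ((χ + η - 1 : ℝ) : ℂ) := by
    intro χ η hp hη h1 h2
    have := isFiniteMeasure_variationMeasure (μ := μ) (a := a) (b := b) (χ := χ) (η := η)
    have := nullSingletonClass_variationMeasure (a := a) (b := b) (χ := χ) (η := η) hμ
    obtain ⟨h1, h1'⟩ := h1.integral_eq_zero hp
    obtain ⟨h2, h2'⟩ := h2.integral_eq_zero hp
    exact hN hp ((isSignedCarrier hp).eq_zero_of_endpoint_of_endpoint
      (signDensity_mul_nonneg hp.2.1.2) h1 h2 (by linarith) h1' h2')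
  have hle : ∀ {χ η : ℝ}, (χ, η) ∈ shape a b → χ + η - 1 ≤ χ := fun hp => hp.2.2.2.1
  refine pairwise_disjoint_fin_of_lt _ fun i j hij => Set.disjoint_left.2 ?_
  rintro ⟨χ, η⟩ hi hj
  fin_cases i <;> fin_cases j <;>
    first
    | exact absurd hij (by decide)
    | skip
  · obtain ⟨hp, w, hw, hr⟩ := hi
    obtain ⟨-, t, -, ht⟩ := hj
    exact hcc hp (hr.isCritical hp hw) ht fun h => absurd h hw
  · obtain ⟨hp, w, hw, hr⟩ := hi
    obtain ⟨-, t, -, ht⟩ := hj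
    exact hcc hp (hr.isCritical hp hw) ht fun h => absurd h hw
  · obtain ⟨hp, w, hw, hr⟩ := hi
    exact hc1 hp (hr.isCritical hp hw) hj.2.2 fun h => absurd h hw
  · obtain ⟨hp, w, hw, hr⟩ := hi
    exact hc1 hp (hr.isCritical hp hw) hj.2.2 fun h => absurd h hw
  · obtain ⟨hp, w, hw, hr⟩ := hi
    exact hc2 hp (hr.isCritical hp hw) hj.2.2 fun h => absurd h hw
  · obtain ⟨hp, t, ht, hr⟩ := hi
    obtain ⟨-, t', ht', hr'⟩ := hj
    exact hcc hp (hr.isCritical hp) hr' fun _ h => ht (by rw [← h]; exact Ioo_subset_Icc_self ht')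
  · obtain ⟨hp, t, ht, hr⟩ := hi
    exact hc1 hp (hr.isCritical hp) hj.2.2 fun _ h => ht (by rw [← h]; exact right_mem_Icc.2 (hle hp))
  · obtain ⟨hp, t, ht, hr⟩ := hi
    exact hc1 hp (hr.isCritical hp) hj.2.2 fun _ h => ht (by rw [← h]; exact right_mem_Icc.2 (hle hp))
  · obtain ⟨hp, t, ht, hr⟩ := hi
    exact hc2 hp (hr.isCritical hp) hj.2.2 fun _ h => ht (by rw [← h]; exact left_mem_Icc.2 (hle hp))
  · obtain ⟨hp, t, ht, hr⟩ := hi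
    exact hc1 hp (hr.isCritical hp) hj.2.2 fun _ => ht.2.ne'
  · obtain ⟨hp, t, ht, hr⟩ := hi
    exact hc1 hp (hr.isCritical hp) hj.2.2 fun _ => ht.2.ne'
  · obtain ⟨hp, t, ht, hr⟩ := hi
    exact hc2 hp (hr.isCritical hp) hj.2.2 fun _ => ht.1.ne
  · exact hj.2.1.ne hi.2.1
  · exact hj.2.1.ne hi.2.1
  · exact h12 hi.1 hi.2.1 hi.2.2 hj.2.2

end GelfandTsetlin

theorem mainTheorem9
    (a b : ℝ) (μ : Measure ℝ) [IsProbabilityMeasure μ]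
    (hab : 1 < b - a) (hsupp : μ.support ⊆ Icc a b)
    (ha : a ∈ μ.support) (hb : b ∈ μ.support)
    (x : (n : ℕ) → Fin n → ℤ) (hx : ∀ n, StrictAnti (x n))
    (hlim : Tendsto (fun n : ℕ => GelfandTsetlin.empiricalMeasure (x n)) atTop
      (𝓝 (⟨μ, inferInstance⟩ : FiniteMeasure ℝ))) :
    (∀ χ η : ℝ,
      (χ, η) ∈ GelfandTsetlin.liquid μ a b ∪ GelfandTsetlin.edgeMu μ a b
          ∪ GelfandTsetlin.edgeLambdaSubMu μ a b →
        (GelfandTsetlin.S₁ μ b χ).Nonempty ∧ (GelfandTsetlin.S₂ μ χ η).Nonempty ∧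
          (GelfandTsetlin.S₃ μ a χ η).Nonempty) ∧
    (∀ χ η : ℝ,
      (χ, η) ∈ GelfandTsetlin.liquid μ a b ∪ GelfandTsetlin.edge μ a b → 0 < η) ∧
    Pairwise (Function.onFun Disjoint
      (![GelfandTsetlin.liquid μ a b, GelfandTsetlin.edgeMu μ a b,
        GelfandTsetlin.edgeLambdaSubMu μ a b, GelfandTsetlin.edge₀ μ a b,
        GelfandTsetlin.edge₁ μ a b, GelfandTsetlin.edge₂ μ a b] : Fin 6 → Set (ℝ × ℝ))) := by
  have hμ : μ ≤ volume := GelfandTsetlin.le_volume_of_tendsto_empiricalMeasure hx hlim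
  have hN : ∀ {χ η}, (χ, η) ∈ GelfandTsetlin.shape a b →
      GelfandTsetlin.variationMeasure μ a b χ η ≠ 0 :=
    GelfandTsetlin.variationMeasure_ne_zero hab hsupp ha hb
  refine ⟨fun χ η h => ?_, fun χ η h =>
    GelfandTsetlin.pos_of_mem_liquid_union_edge hμ hsupp hN h,
    GelfandTsetlin.pairwise_disjoint_liquid_edges hμ hN⟩
  obtain ⟨u, v, hc⟩ := GelfandTsetlin.exists_isCritical_of_mem h
  have hp := GelfandTsetlin.mem_shape_of_mem h
  exact hc.nonempty_supports hμ hp (hN hp)
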